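/- Fix $p\in(0,1)$ and a finite simple graph $H$ with $h$ vertices and at least one edge. For $n\ge 1$ let $G\in\mathbb G(n,p)$ be the binomial random graph on $n$ labelled vertices, in which every pair of vertices is an edge with probability $p$ independently, and let $X_H$ be the number of copies of $H$ in $G$, that is, of (not necessarily induced) subgraphs of $G$ isomorphic to $H$. Then there is a constant $C$, depending only on $p$ and $H$, such that for every $n\ge 1$ and every $x\in\mathbb R$, $$\Pr\left(|X_H-x|\le n^{h-2}\right)\le \frac{C}{n}.$$ The order of magnitude $1/n$ is optimal: there is a constant $c>0$, depending only on $p$ and $H$, such that for every $n\ge 1$ there is an $x\in\mathbb N$ with $$\Pr\left(|X_H-x|\le n^{h-2}\right)\ge \frac{c}{n}.$$ -/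

import Mathlib

open SimpleGraph

/-! ### Random subsets of a finite set: expectation, Markov, Chebyshev. -/

section BinomialSubset

open Finset

variable {α ι : Type*}

/-! Upper bound. Let L be the number of labelled copies: it is a monotone function of the edge set
S, and equals |Aut H| times the number of copies. Let U be the set of all N pairs of vertices and
let d be a small multiple of n^(h-2). For a fixed pair e, the copies rooted at e have mean of order
n^(h-2) and variance O(n^(2(h-2)-1)), so by Chebyshev the event that e is absent and adding it
raises L by less than d has probability O(1/n) (`binProb_no_jump_le`). By Markov, outside an event
of probability O(1/n), a constant fraction of U consists of absent pairs whose addition raises L by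
at least d (`binProb_few_good_le`).

The sets with that many jumps and with L in the window are handled by an LYM-type argument
(`sum_inv_choose_le`). Clamp L to a slightly longer interval and average it over each level of the
cube. The averages increase by O(n^(h-2)) in total, whereas a proportion θ of such sets on one level
forces an increase of order θ n^(h-2) to the next. Hence the proportions over all levels sum to
O(1). The probability is the sum of these proportions weighted by binomial point masses, each of
which is O(1/√N) = O(1/n) (`exists_binomial_le_div_sqrt`).

Lower bound. The variance of L is O(n^(2h-2)), so with probability at least 3/4 the count falls in
one of O(n) windows of length n^(h-2), and the pigeonhole principle applies
(`exists_le_binProb_of_concentrated`). -/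

/-- The expectation of `f S`, where `S` is a random subset of `U` containing each element
independently with probability `p`. -/
noncomputable def binExp (p : ℝ) (U : Finset α) (f : Finset α → ℝ) : ℝ :=
  ∑ S ∈ U.powerset, p ^ #S * (1 - p) ^ (#U - #S) * f S

open Classical in
/-- The probability that a `p`-random subset of `U` satisfies `P`. -/
noncomputable def binProb (p : ℝ) (U : Finset α) (P : Finset α → Prop) : ℝ :=
  binExp p U fun S => if P S then 1 else 0

variable {p : ℝ} {U : Finset α} {f g : Finset α → ℝ} {P Q R : Finset α → Prop}

lemma binExp_mono (hp0 : 0 ≤ p) (hp1 : p ≤ 1) (h : ∀ S ⊆ U, f S ≤ g S) :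
    binExp p U f ≤ binExp p U g := by
  have : 0 ≤ 1 - p := by linarith
  exact sum_le_sum fun S hS => mul_le_mul_of_nonneg_left (h S (mem_powerset.1 hS)) (by positivity)

lemma binExp_congr (h : ∀ S ⊆ U, f S = g S) : binExp p U f = binExp p U g :=
  sum_congr rfl fun S hS => by rw [h S (mem_powerset.1 hS)]

lemma binExp_const (c : ℝ) : binExp p U (fun _ => c) = c := by
  rw [binExp, ← sum_mul, sum_pow_mul_eq_add_pow]
  simp

lemma binExp_add : binExp p U (fun S => f S + g S) = binExp p U f + binExp p U g := by
  simp only [binExp, mul_add, sum_add_distrib]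

lemma binExp_sub : binExp p U (fun S => f S - g S) = binExp p U f - binExp p U g := by
  simp only [binExp, mul_sub, sum_sub_distrib]

lemma binExp_const_mul (c : ℝ) : binExp p U (fun S => c * f S) = c * binExp p U f := by
  simp only [binExp, mul_sum]
  exact sum_congr rfl fun _ _ => by ring

lemma binExp_sum (I : Finset ι) (f : ι → Finset α → ℝ) :
    binExp p U (fun S => ∑ i ∈ I, f i S) = ∑ i ∈ I, binExp p U (f i) := by
  simp only [binExp, mul_sum]
  exact sum_comm

lemma binProb_mono (hp0 : 0 ≤ p) (hp1 : p ≤ 1) (h : ∀ S ⊆ U, P S → Q S) :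
    binProb p U P ≤ binProb p U Q := by
  refine binExp_mono hp0 hp1 fun S hS => ?_
  have := h S hS
  split_ifs <;> first | tauto | norm_num

lemma binProb_le_one (hp0 : 0 ≤ p) (hp1 : p ≤ 1) : binProb p U P ≤ 1 := by
  refine (binExp_mono (g := fun _ => 1) hp0 hp1 fun S _ => ?_).trans_eq (binExp_const 1)
  split_ifs <;> norm_num

lemma binProb_le_add (hp0 : 0 ≤ p) (hp1 : p ≤ 1) (h : ∀ S ⊆ U, P S → Q S ∨ R S) :
    binProb p U P ≤ binProb p U Q + binProb p U R := by
  simp only [binProb]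
  rw [← binExp_add]
  refine binExp_mono hp0 hp1 fun S hS => ?_
  have := h S hS
  split_ifs <;> first | tauto | norm_num

lemma binProb_add_not : binProb p U P + binProb p U (fun S => ¬ P S) = 1 := by
  simp only [binProb]
  rw [← binExp_add]
  refine (binExp_congr (g := fun _ => 1) fun S _ => ?_).trans (binExp_const 1)
  split_ifs <;> norm_num

/-- Markov's inequality. -/
lemma binProb_le_div (hp0 : 0 ≤ p) (hp1 : p ≤ 1) (hf : ∀ S ⊆ U, 0 ≤ f S) {t : ℝ} (ht : 0 < t)
    (h : ∀ S ⊆ U, P S → t ≤ f S) : binProb p U P ≤ binExp p U f / t := by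
  rw [le_div_iff₀ ht, mul_comm, binProb, ← binExp_const_mul]
  refine binExp_mono hp0 hp1 fun S hS => ?_
  split_ifs with hP
  · simpa using h S hS hP
  · simpa using hf S hS

variable [DecidableEq α]

/-- Expand the product over `U` of p + (1 - p), with 1 - p replaced by 0 at the elements of `A`:
this kills exactly the terms of the sets that miss an element of `A`. -/
lemma binExp_subset {A : Finset α} (hA : A ⊆ U) :
    binExp p U (fun S => if A ⊆ S then 1 else 0) = p ^ #A := by
  have h := prod_add (fun _ => p) (fun i => if i ∈ A then 0 else 1 - p) U
  have h1 : ∏ i ∈ U, (p + if i ∈ A then 0 else 1 - p) = p ^ #A := by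
    rw [← prod_const, ← prod_subset hA]
    · exact prod_congr rfl fun i hi => by simp [hi]
    · intro i _ hi; simp [hi]
  rw [h1] at h
  rw [h, binExp]
  refine sum_congr rfl fun S hS => ?_
  rw [mem_powerset] at hS
  rw [prod_const, mul_assoc]
  congr 1
  split_ifs with hAS
  · rw [← card_sdiff_of_subset hS, mul_one, ← prod_const]
    refine prod_congr rfl fun i hi => ?_
    have : i ∉ A := fun hi' => (mem_sdiff.1 hi).2 (hAS hi')
    simp [this]
  · obtain ⟨i, hiA, hiS⟩ := not_subset.1 hAS
    rw [mul_zero]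
    exact (prod_eq_zero (mem_sdiff.2 ⟨hA hiA, hiS⟩) (by simp [hiA])).symm

/-- The variance of the number of sets of a family that are contained in the random set is at most
the number of intersecting pairs. -/
lemma binExp_variance_le (hp0 : 0 ≤ p) (hp1 : p ≤ 1) (I : Finset ι) (A : ι → Finset α)
    (hA : ∀ i ∈ I, A i ⊆ U) :
    binExp p U (fun S => ((∑ i ∈ I, if A i ⊆ S then 1 else 0) - ∑ i ∈ I, p ^ #(A i)) ^ 2) ≤
      #{x ∈ I ×ˢ I | ¬ Disjoint (A x.1) (A x.2)} := by
  have h1 : ∀ S : Finset α,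
      (((∑ i ∈ I, if A i ⊆ S then 1 else 0) - ∑ i ∈ I, p ^ #(A i)) ^ 2 : ℝ) =
      ∑ x ∈ I ×ˢ I, ((if A x.1 ⊆ S then 1 else 0) - p ^ #(A x.1)) *
        ((if A x.2 ⊆ S then 1 else 0) - p ^ #(A x.2)) := by
    intro S
    rw [← sum_sub_distrib, sq, sum_mul_sum, sum_product]
  rw [binExp_congr fun S _ => h1 S, binExp_sum, card_filter, Nat.cast_sum]
  refine sum_le_sum fun x hx => ?_
  obtain ⟨hx1, hx2⟩ := mem_product.1 hx
  have h2 : ∀ S : Finset α, (((if A x.1 ⊆ S then 1 else 0) - p ^ #(A x.1)) *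
        ((if A x.2 ⊆ S then 1 else 0) - p ^ #(A x.2)) : ℝ) =
      (if A x.1 ∪ A x.2 ⊆ S then 1 else 0) - p ^ #(A x.2) * (if A x.1 ⊆ S then 1 else 0)
        - p ^ #(A x.1) * (if A x.2 ⊆ S then 1 else 0) + p ^ #(A x.1) * p ^ #(A x.2) := by
    intro S
    simp only [union_subset_iff]
    split_ifs <;> first | tauto | ring
  rw [binExp_congr fun S _ => h2 S, binExp_add, binExp_sub, binExp_sub, binExp_const_mul,
    binExp_const_mul, binExp_const, binExp_subset (hA _ hx1), binExp_subset (hA _ hx2),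
    binExp_subset (union_subset (hA _ hx1) (hA _ hx2))]
  -- Disjoint pairs have covariance 0; any other covariance is at most 1.
  split_ifs with hd
  · rw [card_union_of_disjoint hd, pow_add]
    push_cast
    linarith
  · have h3 : p ^ #(A x.1 ∪ A x.2) ≤ 1 := pow_le_one₀ hp0 hp1
    have h4 : 0 ≤ p ^ #(A x.1) * p ^ #(A x.2) := by positivity
    push_cast
    nlinarith

/-- Chebyshev's inequality for the number of sets of a family contained in the random set. -/
lemma binProb_chebyshev (hp0 : 0 ≤ p) (hp1 : p ≤ 1) (I : Finset ι) (A : ι → Finset α)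
    (hA : ∀ i ∈ I, A i ⊆ U) {t : ℝ} (ht : 0 < t)
    (h : ∀ S ⊆ U, P S → t ≤ |(#{i ∈ I | A i ⊆ S} : ℝ) - ∑ i ∈ I, p ^ #(A i)|) :
    binProb p U P ≤ #{x ∈ I ×ˢ I | ¬ Disjoint (A x.1) (A x.2)} / t ^ 2 := by
  refine (binProb_le_div hp0 hp1 (fun S _ => sq_nonneg _) (pow_pos ht 2) fun S hS hP => ?_).trans
    (div_le_div_of_nonneg_right (binExp_variance_le hp0 hp1 I A hA) (by positivity))
  have := h S hS hP
  rw [card_filter] at this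
  push_cast at this
  rw [← sq_abs (_ - _)]
  gcongr

end BinomialSubset

/-! ### Point masses of the binomial distribution. -/

section PointMass

open Finset

lemma sum_range_binomial_le_one {p : ℝ} (hp0 : 0 ≤ p) (hp1 : p ≤ 1) (N T : ℕ) :
    ∑ k ∈ range T, (N.choose k : ℝ) * p ^ k * (1 - p) ^ (N - k) ≤ 1 := by
  have hq : 0 ≤ 1 - p := by linarith
  calc ∑ k ∈ range T, (N.choose k : ℝ) * p ^ k * (1 - p) ^ (N - k)
      ≤ ∑ k ∈ range (T + (N + 1)), (N.choose k : ℝ) * p ^ k * (1 - p) ^ (N - k) :=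
        sum_le_sum_of_subset_of_nonneg (range_mono (by omega)) fun _ _ _ => by positivity
    _ = ∑ k ∈ range (N + 1), (N.choose k : ℝ) * p ^ k * (1 - p) ^ (N - k) := by
        symm
        refine sum_subset (range_mono (by omega)) fun k _ hk => ?_
        rw [mem_range] at hk
        rw [Nat.choose_eq_zero_of_lt (by omega)]
        simp
    _ = (p + (1 - p)) ^ N := by
        rw [add_pow]
        exact sum_congr rfl fun _ _ => by ring
    _ = 1 := by simp

/-- The point masses of the binomial distribution are `O(1 / √N)`. -/
lemma exists_binomial_le_div_sqrt {p : ℝ} (hp0 : 0 < p) (hp1 : p < 1) :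
    ∃ C : ℝ, 0 < C ∧ ∀ N : ℕ, 1 ≤ N → ∀ k : ℕ,
      (N.choose k : ℝ) * p ^ k * (1 - p) ^ (N - k) ≤ C / √N := by
  have hq : 0 < 1 - p := by linarith
  refine ⟨2 / √(p * (1 - p) / 2), by positivity, fun N hN k => ?_⟩
  set b : ℕ → ℝ := fun k => (N.choose k : ℝ) * p ^ k * (1 - p) ^ (N - k) with hb
  have hN0 : (0 : ℝ) < N := by exact_mod_cast hN
  have hb0 : ∀ k, 0 ≤ b k := fun k => by positivity
  -- The ratio of consecutive terms, cleared of denominators so that it also holds for k ≥ N.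
  have hrec : ∀ k : ℕ, (k + 1 : ℝ) * (1 - p) * b (k + 1) = (N - k) * p * b k := by
    intro k
    rcases lt_or_ge k N with hk | hk
    · have h1 : (N.choose (k + 1) : ℝ) * (k + 1) = N.choose k * (N - k) := by
        have := Nat.choose_succ_right_eq N k
        rw [← Nat.cast_sub hk.le]
        exact_mod_cast this
      have h2 : N - k = N - (k + 1) + 1 := by omega
      simp only [hb]
      rw [h2, pow_succ, pow_succ]
      linear_combination p ^ k * p * (1 - p) ^ (N - (k + 1)) * (1 - p) * h1
    · have h1 : b (k + 1) = 0 := by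
        simp [hb, Nat.choose_eq_zero_of_lt (show N < k + 1 by omega)]
      rcases hk.eq_or_lt with rfl | hk
      · simp [h1]
      · have h2 : b k = 0 := by simp [hb, Nat.choose_eq_zero_of_lt hk]
        simp [h1, h2]
  obtain ⟨m, -, hm⟩ := exists_max_image (range (N + 1)) b ⟨0, by simp⟩
  have hmax : ∀ k, b k ≤ b m := by
    intro k
    by_cases hk : k < N + 1
    · exact hm k (mem_range.2 hk)
    · have : b k = 0 := by simp [hb, Nat.choose_eq_zero_of_lt (show N < k by omega)]
      rw [this]; exact hb0 m
  have hpos : 0 < b m := lt_of_lt_of_le (by simp only [hb]; simp; positivity) (hmax 0)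
  -- Comparing `b m` with its two neighbours places the mode between Np - 1 and (N + 1)p.
  have hlow : N * p ≤ m + 1 := by
    have h1 := hrec m
    have h2 := mul_le_mul_of_nonneg_left (hmax (m + 1))
      (show 0 ≤ (m + 1 : ℝ) * (1 - p) by positivity)
    rw [h1] at h2
    have := le_of_mul_le_mul_right h2 hpos
    nlinarith
  have hup : m * (1 - p) ≤ (N - m + 1) * p := by
    rcases Nat.eq_zero_or_pos m with h0 | h0
    · rw [h0]; push_cast; nlinarith
    · obtain ⟨l, rfl⟩ : ∃ l, m = l + 1 := ⟨m - 1, by omega⟩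
      have h1 := hrec l
      have hlN : (l : ℝ) ≤ N := by
        by_contra! h
        have : b (l + 1) = 0 := by
          simp [hb, Nat.choose_eq_zero_of_lt (show N < l + 1 by have : N < l := by
                                                                  exact_mod_cast h
                                                                omega)]
        linarith
      have h2 := mul_le_mul_of_nonneg_left (hmax l)
        (show 0 ≤ (N - l : ℝ) * p by have : (0 : ℝ) ≤ N - l := by linarith
                                     positivity)
      rw [← h1] at h2
      have := le_of_mul_le_mul_right h2 hpos
      push_cast
      nlinarith
  -- `D` is the variance and `J` has the order of the standard deviation. For `J` steps after the
  -- mode, consecutive ratios are at least 1 - J/D, so these terms stay above (1 - J²/D) b m ≥ b m /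
  -- 2. There are J + 1 of them, and they sum to at most 1.
  set D : ℝ := N * (p * (1 - p)) with hD
  have hD0 : 0 < D := by positivity
  set J : ℕ := ⌊√(D / 2)⌋₊ with hJ
  have hJ2 : (J : ℝ) * J ≤ D / 2 := by
    have h1 : (J : ℝ) ≤ √(D / 2) := Nat.floor_le (by positivity)
    calc (J : ℝ) * J ≤ √(D / 2) * √(D / 2) := by gcongr
      _ = D / 2 := Real.mul_self_sqrt (by positivity)
  have hstep : ∀ j : ℕ, j ≤ J → (1 - j * (J / D)) * b m ≤ b (m + j) := by
    intro j
    induction j with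
    | zero => intro _; simp
    | succ j ih =>
      intro hj
      have hjJ : (j + 1 : ℝ) ≤ J := by exact_mod_cast hj
      have h1 := ih (by omega)
      have h2 := hrec (m + j)
      push_cast at h2 ⊢
      rw [← add_assoc]
      set M : ℝ := m + j + 1 with hM
      have hMD : D ≤ M * (1 - p) := by
        rw [hD, hM, ← mul_assoc]
        gcongr
        have : (0 : ℝ) ≤ j := by positivity
        linarith
      have hM0 : 0 < M * (1 - p) := by linarith
      have h3 : (M * (1 - p) - (j + 1)) * b (m + j) ≤ M * (1 - p) * b (m + j + 1) := by
        rw [h2]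
        refine mul_le_mul_of_nonneg_right ?_ (hb0 _)
        rw [hM]
        nlinarith
      have h4 : (1 - J / D) * b (m + j) ≤ b (m + j + 1) := by
        refine le_of_mul_le_mul_left ?_ hM0
        refine le_trans ?_ h3
        rw [← mul_assoc]
        refine mul_le_mul_of_nonneg_right ?_ (hb0 _)
        have : (J : ℝ) ≤ M * (1 - p) * (J / D) := by
          rw [mul_div_assoc', le_div_iff₀ hD0, mul_comm]
          gcongr
        linarith
      have h5 : J / D ≤ 1 := by
        rw [div_le_one hD0]
        have hJ0 : (1 : ℝ) ≤ J := by have : (0 : ℝ) ≤ j := by positivity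
                                     linarith
        nlinarith
      have h6 : 0 ≤ J / D := by positivity
      calc (1 - (j + 1) * (J / D)) * b m ≤ (1 - J / D) * ((1 - j * (J / D)) * b m) := by
            refine le_of_le_of_eq (mul_le_mul_of_nonneg_right ?_ (hb0 m)) (mul_assoc _ _ _)
            have : 0 ≤ (j : ℝ) * (J / D) * (J / D) := by positivity
            nlinarith
        _ ≤ (1 - J / D) * b (m + j) := by
            have : 0 ≤ 1 - J / D := by linarith
            gcongr
        _ ≤ _ := h4
  have hhalf : ∀ j ∈ range (J + 1), b m / 2 ≤ b (m + j) := by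
    intro j hj
    rw [mem_range] at hj
    refine le_trans ?_ (hstep j (by omega))
    have h1 : (j : ℝ) ≤ J := by exact_mod_cast (show j ≤ J by omega)
    have h2 : (j : ℝ) * (J / D) ≤ 1 / 2 := by
      rw [mul_div_assoc', div_le_iff₀ hD0]
      have : (j : ℝ) * J ≤ J * J := by gcongr
      linarith
    nlinarith
  have hsum : (J + 1) * (b m / 2) ≤ 1 := by
    have h1 := card_nsmul_le_sum _ _ _ hhalf
    rw [card_range, nsmul_eq_mul] at h1
    push_cast at h1
    refine h1.trans ?_
    have h2 := sum_range_binomial_le_one hp0.le hp1.le N (m + (J + 1))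
    rw [sum_range_add] at h2
    have h3 : 0 ≤ ∑ k ∈ range m, (N.choose k : ℝ) * p ^ k * (1 - p) ^ (N - k) :=
      sum_nonneg fun k _ => hb0 k
    linarith
  have hJl : √(D / 2) ≤ J + 1 := (Nat.lt_floor_add_one _).le
  have hsq : √(D / 2) = √(p * (1 - p) / 2) * √N := by
    rw [← Real.sqrt_mul (by positivity)]
    congr 1
    rw [hD]; ring
  refine (hmax k).trans ?_
  rw [div_div, ← hsq, le_div_iff₀ (by positivity)]
  nlinarith

end PointMass

/-! ### Level averages of monotone functions on the cube. -/

section Levels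

open Finset

variable {α : Type*} [DecidableEq α] {U : Finset α}

/-- Double counting: each set of size m + 1 arises once from each of its elements. -/
lemma sum_powersetCard_sum_insert (F : Finset α → ℝ) (m : ℕ) :
    ∑ S ∈ U.powersetCard m, ∑ e ∈ U \ S, F (insert e S) =
      (m + 1) * ∑ T ∈ U.powersetCard (m + 1), F T := by
  have h1 : (m + 1) * ∑ T ∈ U.powersetCard (m + 1), F T =
      ∑ T ∈ U.powersetCard (m + 1), ∑ _e ∈ T, F T := by
    rw [mul_sum]
    refine sum_congr rfl fun T hT => ?_
    rw [sum_const, (mem_powersetCard.1 hT).2, nsmul_eq_mul]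
    push_cast; ring
  rw [h1, sum_sigma', sum_sigma']
  refine sum_bij' (fun x _ => ⟨insert x.2 x.1, x.2⟩) (fun x _ => ⟨x.1.erase x.2, x.2⟩) ?_ ?_ ?_ ?_ ?_
  · rintro ⟨S, e⟩ h
    simp only [mem_sigma, mem_powersetCard, mem_sdiff] at h ⊢
    exact ⟨⟨insert_subset h.2.1 h.1.1, by rw [card_insert_of_notMem h.2.2, h.1.2]⟩,
      mem_insert_self _ _⟩
  · rintro ⟨T, e⟩ h
    simp only [mem_sigma, mem_powersetCard, mem_sdiff] at h ⊢
    exact ⟨⟨(erase_subset _ _).trans h.1.1, by rw [card_erase_of_mem h.2, h.1.2]; rfl⟩,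
      h.1.1 h.2, notMem_erase _ _⟩
  · rintro ⟨S, e⟩ h
    simp only [mem_sigma, mem_powersetCard, mem_sdiff] at h
    simp [erase_insert h.2.2]
  · rintro ⟨T, e⟩ h
    simp only [mem_sigma, mem_powersetCard] at h
    simp [insert_erase h.2]
  · rintro ⟨S, e⟩ _
    rfl

/-- If a monotone set function has many jumps at every member of a family `𝒜` and nearly the same
value on the whole family, then the family is small in the sense of the LYM inequality. -/
lemma sum_inv_choose_le {L : Finset α → ℝ} (hL : Monotone L) {d r γ x : ℝ} (hd : 0 < d)
    (hr : 0 ≤ r) (hγ : 0 < γ) (hU : U.Nonempty) {𝒜 : Finset (Finset α)}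
    (hA : ∀ S ∈ 𝒜, S ⊆ U ∧ |L S - x| ≤ r ∧
      γ * #U ≤ #{e ∈ U \ S | L S + d ≤ L (insert e S)}) :
    ∑ S ∈ 𝒜, (1 / (#U).choose #S : ℝ) ≤ (2 * r + d) / (d * γ) := by
  set N := #U with hN
  have hN0 : (0 : ℝ) < N := by exact_mod_cast hU.card_pos
  -- The upper cutoff exceeds the window by `d`, so that a jump of `d` from inside the window is not
  -- truncated.
  set F : Finset α → ℝ := fun S => max (x - r) (min (L S) (x + r + d)) with hF
  have hFmono : Monotone F := fun S T hST => max_le_max le_rfl (min_le_min (hL hST) le_rfl)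
  have hFl : ∀ S, x - r ≤ F S := fun S => le_max_left _ _
  have hFu : ∀ S, F S ≤ x + r + d := fun S => max_le (by linarith) (min_le_right _ _)
  -- The full set `U` is not in `𝒜`, since no element can be added to it.
  have hcard : ∀ S ∈ 𝒜, #S ∈ range N := by
    intro S hS
    obtain ⟨h1, -, h3⟩ := hA S hS
    rw [mem_range]
    refine card_lt_card (h1.ssubset_of_ne ?_)
    rintro rfl
    simp only [sdiff_self, bot_eq_empty, filter_empty, card_empty, Nat.cast_zero] at h3
    nlinarith
  set a : ℕ → ℝ := fun m => (∑ S ∈ U.powersetCard m, F S) / N.choose m with ha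
  have hstep : ∀ m ∈ range N, d * γ * (#{S ∈ 𝒜 | #S = m} / N.choose m : ℝ) ≤ a (m + 1) - a m := by
    intro m hm
    rw [mem_range] at hm
    have hmN : (0 : ℝ) < N - m := by
      have : (m : ℝ) < N := by exact_mod_cast hm
      linarith
    have hc0 : (0 : ℝ) < N.choose m := by exact_mod_cast Nat.choose_pos hm.le
    have hc1 : (0 : ℝ) < N.choose (m + 1) := by exact_mod_cast Nat.choose_pos hm
    have hrec : (N.choose (m + 1) : ℝ) * (m + 1) = N.choose m * (N - m) := by
      rw [← Nat.cast_sub hm.le]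
      exact_mod_cast Nat.choose_succ_right_eq N m
    -- The increment of the level averages is the mean of F(S ∪ {e}) - F(S) over a uniform pair (S,
    -- e) with |S| = m and e outside S.
    have hdiff : a (m + 1) - a m = (∑ S ∈ U.powersetCard m, ∑ e ∈ U \ S, (F (insert e S) - F S)) /
        (N.choose m * (N - m)) := by
      have h1 : ∑ S ∈ U.powersetCard m, ∑ e ∈ U \ S, (F (insert e S) - F S) =
          (m + 1) * ∑ T ∈ U.powersetCard (m + 1), F T - (N - m) * ∑ S ∈ U.powersetCard m, F S := by
        simp only [sum_sub_distrib, sum_powersetCard_sum_insert, mul_sum]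
        congr 1
        refine sum_congr rfl fun S hS => ?_
        obtain ⟨h2, h3⟩ := mem_powersetCard.1 hS
        rw [sum_const, card_sdiff_of_subset h2, h3, nsmul_eq_mul, Nat.cast_sub hm.le]
      rw [h1, sub_div, ha]
      congr 1
      · rw [← hrec, mul_comm (N.choose (m + 1) : ℝ)]
        field_simp
      · rw [mul_comm (N.choose m : ℝ)]
        field_simp
    rw [hdiff, mul_div_assoc', div_le_div_iff₀ hc0 (by positivity)]
    have hsum : #{S ∈ 𝒜 | #S = m} * (γ * N * d) ≤
        ∑ S ∈ U.powersetCard m, ∑ e ∈ U \ S, (F (insert e S) - F S) := by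
      have hnn : ∀ S, ∀ e ∈ U \ S, 0 ≤ F (insert e S) - F S := fun S e _ =>
        sub_nonneg.2 (hFmono (subset_insert _ _))
      calc (#{S ∈ 𝒜 | #S = m} * (γ * N * d) : ℝ) = ∑ S ∈ 𝒜 with #S = m, γ * N * d := by
            rw [sum_const, nsmul_eq_mul]
        _ ≤ ∑ S ∈ 𝒜 with #S = m, ∑ e ∈ U \ S, (F (insert e S) - F S) := by
            refine sum_le_sum fun S hS => ?_
            obtain ⟨hS, -⟩ := mem_filter.1 hS
            obtain ⟨h1, h2, h3⟩ := hA S hS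
            calc γ * N * d ≤ #{e ∈ U \ S | L S + d ≤ L (insert e S)} * d := by gcongr
              _ = ∑ e ∈ U \ S with L S + d ≤ L (insert e S), d := by
                  rw [sum_const, nsmul_eq_mul]
              _ ≤ ∑ e ∈ U \ S with L S + d ≤ L (insert e S), (F (insert e S) - F S) := by
                  refine sum_le_sum fun e he => ?_
                  have h4 := (mem_filter.1 he).2
                  rw [abs_le] at h2
                  have h5 : F S = L S := by
                    simp only [hF]
                    rw [min_eq_left (by linarith), max_eq_right (by linarith)]
                  have h6 : L S + d ≤ F (insert e S) :=
                    (le_min h4 (by linarith)).trans (le_max_right _ _)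
                  linarith
              _ ≤ _ := sum_le_sum_of_subset_of_nonneg (filter_subset _ _)
                  fun e he _ => hnn S e he
        _ ≤ _ := by
            refine sum_le_sum_of_subset_of_nonneg (fun S hS => ?_)
              fun S _ _ => sum_nonneg (hnn S)
            obtain ⟨hS, hc⟩ := mem_filter.1 hS
            exact mem_powersetCard.2 ⟨(hA S hS).1, hc⟩
    have h7 : (N - m : ℝ) ≤ N := by
      have : (0 : ℝ) ≤ m := by positivity
      linarith
    calc d * γ * #{S ∈ 𝒜 | #S = m} * (N.choose m * (N - m))
        ≤ d * γ * #{S ∈ 𝒜 | #S = m} * (N.choose m * N) := by gcongr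
      _ = #{S ∈ 𝒜 | #S = m} * (γ * N * d) * N.choose m := by ring
      _ ≤ _ := by gcongr
  have htot : ∑ S ∈ 𝒜, (1 / N.choose #S : ℝ) =
      ∑ m ∈ range N, (#{S ∈ 𝒜 | #S = m} / N.choose m : ℝ) := by
    rw [← sum_fiberwise_of_maps_to hcard]
    refine sum_congr rfl fun m _ => ?_
    rw [sum_congr rfl (g := fun _ => (1 / N.choose m : ℝ))
      fun S hS => by rw [(mem_filter.1 hS).2], sum_const, nsmul_eq_mul, mul_one_div]
  rw [htot, le_div_iff₀ (by positivity), mul_comm, mul_sum]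
  refine (sum_le_sum hstep).trans ?_
  rw [sum_range_sub]
  have h8 : a N = F U := by simp [ha, hN]
  have h9 : a 0 = F ∅ := by simp [ha]
  rw [h8, h9]
  linarith [hFl ∅, hFu U]

/-- Anticoncentration of a monotone function on the part of the cube where it has many jumps. -/
lemma binProb_le_of_jumps {L : Finset α → ℝ} (hL : Monotone L) {p d r γ x B : ℝ}
    (hd : 0 < d) (hr : 0 ≤ r) (hγ : 0 < γ)
    (hU : U.Nonempty)
    (hB : ∀ k, ((#U).choose k : ℝ) * p ^ k * (1 - p) ^ (#U - k) ≤ B) {P : Finset α → Prop}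
    (hP : ∀ S ⊆ U, P S → |L S - x| ≤ r ∧
      γ * #U ≤ #{e ∈ U \ S | L S + d ≤ L (insert e S)}) :
    binProb p U P ≤ B * ((2 * r + d) / (d * γ)) := by
  classical
  -- At k = N + 1 the binomial coefficient vanishes.
  have hB0 : 0 ≤ B := by
    have := hB (#U + 1)
    simpa using this
  refine le_trans ?_ (mul_le_mul_of_nonneg_left (sum_inv_choose_le hL hd hr hγ hU
    (𝒜 := {S ∈ U.powerset | P S}) (x := x) fun S hS => ?_) hB0)
  · rw [binProb, binExp, mul_sum, sum_filter]
    refine sum_le_sum fun S hS => ?_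
    split_ifs
    · have hc : (0 : ℝ) < (#U).choose #S := by
        exact_mod_cast Nat.choose_pos (card_le_card (mem_powerset.1 hS))
      rw [mul_one, mul_one_div, le_div_iff₀ hc]
      refine le_trans (le_of_eq ?_) (hB #S)
      ring
    · simp
  · obtain ⟨h1, h2⟩ := mem_filter.1 hS
    exact ⟨mem_powerset.1 h1, hP S (mem_powerset.1 h1) h2⟩

end Levels

/-! ### Labelled and unlabelled copies. -/

section Copies

open Finset

variable {V W : Type*} {H : SimpleGraph W}

/-- Isomorphisms onto a subgraph of `G` are the same as copies with that image. -/
lemma SimpleGraph.card_copy_toSubgraph_eq (H : SimpleGraph W) {G : SimpleGraph V}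
    (G' : G.Subgraph) :
    Nat.card {f : Copy H G // f.toSubgraph = G'} = Nat.card (H ≃g G'.coe) := by
  symm
  refine Nat.card_congr (Equiv.ofBijective (fun e => ⟨⟨G'.hom.comp e.toHom,
    Subgraph.hom_injective.comp e.injective⟩, by simp [Copy.toSubgraph, Subgraph.map_comp]⟩)
    ⟨fun e e' h => ?_, ?_⟩)
  · ext w
    have := congrArg (fun f : {f : Copy H G // f.toSubgraph = G'} => f.1 w) h
    exact this
  · rintro ⟨f, rfl⟩
    exact ⟨f.isoToSubgraph, rfl⟩

/-- Every unlabelled copy of `H` comes from `|Aut H|` labelled copies. -/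
lemma SimpleGraph.labelledCopyCount_eq_card_iso_mul [Fintype V] [Fintype W] (G : SimpleGraph V)
    (H : SimpleGraph W) :
    G.labelledCopyCount H = Nat.card (H ≃g H) * G.copyCount H := by
  classical
  rw [copyCount_eq_card_image_copyToSubgraph, labelledCopyCount, ← Finset.card_univ,
    card_eq_sum_card_image Copy.toSubgraph univ, mul_comm, ← smul_eq_mul, ← sum_const]
  refine sum_congr rfl fun G' hG' => ?_
  obtain ⟨f, -, rfl⟩ := mem_image.1 hG'
  rw [← Fintype.card_subtype, ← Nat.card_eq_fintype_card, card_copy_toSubgraph_eq]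
  exact Nat.card_congr
    ⟨fun e => e.trans f.isoToSubgraph.symm, fun e => e.trans f.isoToSubgraph,
      fun e => by ext; simp, fun e => by ext; simp⟩

variable [Fintype V] [Fintype W]

open Classical in
/-- The edges of the image of `H` under a map of the vertices. -/
noncomputable def edgeImage (H : SimpleGraph W) (φ : W → V) : Finset (Sym2 V) :=
  H.edgeFinset.image (Sym2.map φ)

variable (V W) in
open Classical in
/-- The injective maps from `W` to `V`. -/
noncomputable def injectiveMaps : Finset (W → V) := {φ | Function.Injective φ}

lemma mem_injectiveMaps {φ : W → V} : φ ∈ injectiveMaps V W ↔ Function.Injective φ := by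
  simp [injectiveMaps]

/-- The number of labelled copies of `H` in the graph with edge set `S`. -/
noncomputable def labelledCount [DecidableEq V] (H : SimpleGraph W) (S : Finset (Sym2 V)) : ℕ :=
  #{φ ∈ injectiveMaps V W | edgeImage H φ ⊆ S}

omit [Fintype V] in
lemma mem_edgeImage {φ : W → V} {e : Sym2 V} :
    e ∈ edgeImage H φ ↔ ∃ a b, H.Adj a b ∧ s(φ a, φ b) = e := by
  simp only [edgeImage, mem_image, mem_edgeFinset]
  constructor
  · rintro ⟨f, hf, rfl⟩
    induction f with
    | h a b => exact ⟨a, b, hf, rfl⟩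
  · rintro ⟨a, b, h, rfl⟩
    exact ⟨s(a, b), h, rfl⟩

lemma SimpleGraph.labelledCopyCount_eq_natCard (G : SimpleGraph V) (H : SimpleGraph W) :
    G.labelledCopyCount H = Nat.card (Copy H G) := by
  classical
  rw [labelledCopyCount, Nat.card_eq_fintype_card]

lemma labelledCount_eq [DecidableEq V] (G : SimpleGraph V) {S : Finset (Sym2 V)} (hS : G.edgeSet = S) :
    labelledCount H S = G.labelledCopyCount H := by
  classical
  rw [labelledCopyCount_eq_natCard, labelledCount, Nat.card_eq_fintype_card, ← Finset.card_univ]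
  symm
  refine card_bij (fun f _ => (f : W → V)) ?_ (fun f _ g _ h => DFunLike.coe_injective h) ?_
  · intro f _
    simp only [mem_filter, mem_injectiveMaps]
    refine ⟨f.injective, fun e he => ?_⟩
    obtain ⟨a, b, hab, rfl⟩ := mem_edgeImage.1 he
    rw [← mem_coe, ← hS]
    exact f.toHom.map_adj hab
  · intro φ hφ
    simp only [mem_filter, mem_injectiveMaps] at hφ
    refine ⟨⟨⟨φ, fun {a b} hab => ?_⟩, hφ.1⟩, mem_univ _, rfl⟩
    rw [← mem_edgeSet, hS]
    exact hφ.2 (mem_edgeImage.2 ⟨a, b, hab, rfl⟩)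

lemma labelledCount_mono [DecidableEq V] (H : SimpleGraph W) :
    Monotone (labelledCount H : Finset (Sym2 V) → ℕ) := fun _ _ hST => by
  exact card_le_card fun φ hφ => by
    rw [mem_filter] at hφ ⊢
    exact ⟨hφ.1, hφ.2.trans hST⟩

omit [Fintype V] in
lemma edgeImage_subset {φ : W → V} (hφ : Function.Injective φ) [DecidableEq V] [Fintype V] :
    edgeImage H φ ⊆ (⊤ : SimpleGraph V).edgeFinset := by
  intro e he
  obtain ⟨a, b, hab, rfl⟩ := mem_edgeImage.1 he
  simp [hφ.ne hab.ne]

end Copies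

/-! ### The random graph as a random set of edges. -/

section Law

open Finset

lemma binomialRandom_real_eq_binProb {V : Type*} [Fintype V] [DecidableEq V] (p : unitInterval)
    (A : Set (SimpleGraph V)) :
    (binomialRandom V p).real A = binProb p (⊤ : SimpleGraph V).edgeFinset
      fun S => fromEdgeSet (S : Set (Sym2 V)) ∈ A := by
  classical
  have : MeasurableSingletonClass (SimpleGraph V) := ⟨fun G => by
    convert measurable_edgeSet (measurableSet_singleton G.edgeSet) using 1
    ext G'
    simp⟩
  have hfin : A.Finite := Set.toFinite A
  have h1 : (binomialRandom V p).real A =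
      ∑ G ∈ hfin.toFinset, (binomialRandom V p).real {G} := by
    rw [MeasureTheory.sum_measureReal_singleton]
    simp
  rw [h1, binProb, binExp]
  simp only [mul_ite, mul_one, mul_zero]
  rw [← sum_filter]
  refine sum_bij' (fun G _ => G.edgeFinset) (fun S _ => fromEdgeSet (S : Set (Sym2 V)))
    ?_ ?_ ?_ ?_ ?_
  · intro G hG
    exact mem_filter.2 ⟨mem_powerset.2 (edgeFinset_mono le_top), by simpa using hG⟩
  · intro S hS
    simpa using (mem_filter.1 hS).2
  · intro G _
    simp
  · intro S hS
    have hS := mem_powerset.1 (mem_filter.1 hS).1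
    ext e
    simp only [mem_edgeFinset, edgeSet_fromEdgeSet, Set.mem_sdiff, mem_coe]
    refine ⟨fun h => h.1, fun h => ⟨h, ?_⟩⟩
    have := hS h
    simpa using this
  · intro G _
    rw [MeasureTheory.measureReal_def, binomialRandom_singleton, ENNReal.toReal_mul,
      ENNReal.toReal_pow, ENNReal.toReal_pow]
    rw [← coe_edgeFinset, Set.ncard_coe_finset, Nat.card_eq_fintype_card,
      card_edgeFinset_top_eq_card_choose_two]
    simp

end Law

/-! ### Counting pairs of copies and rooted copies. -/

section Counting

open Finset

variable {W : Type*} [Fintype W] {H : SimpleGraph W} {n : ℕ}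

/-- A set of pairs of maps that are determined by their values off `T` and `T'` is small. -/
lemma card_pairs_le (s : Finset ((W → Fin n) × (W → Fin n))) (T T' : Finset W)
    (h : ∀ x ∈ s, ∀ y ∈ s, (∀ i ∉ T, x.1 i = y.1 i) → (∀ i ∉ T', x.2 i = y.2 i) → x = y) :
    #s ≤ n ^ (Fintype.card W - #T) * n ^ (Fintype.card W - #T') := by
  classical
  have h1 := card_le_card_of_injOn (s := s)
    (t := (univ : Finset (({i // i ∉ T} → Fin n) × ({i // i ∉ T'} → Fin n))))
    (fun x => (fun i => x.1 i, fun i => x.2 i)) (fun _ _ => mem_univ _)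
    (fun x hx y hy hxy => by
      rw [Prod.mk.injEq] at hxy
      exact h x hx y hy (fun i hi => congrFun hxy.1 ⟨i, hi⟩) fun i hi => congrFun hxy.2 ⟨i, hi⟩)
  refine h1.trans_eq ?_
  simp [Fintype.card_subtype_compl]

open Classical in
/-- The number of pairs of labelled copies of `H` that share an edge. -/
lemma card_intersecting_le (H : SimpleGraph W) (n : ℕ) :
    #{x ∈ injectiveMaps (Fin n) W ×ˢ injectiveMaps (Fin n) W |
      ¬ Disjoint (edgeImage H x.1) (edgeImage H x.2)} ≤
    Fintype.card W ^ 4 * (n ^ Fintype.card W * n ^ (Fintype.card W - 2)) := by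
  set I := injectiveMaps (Fin n) W
  -- A shared edge makes the second map agree at two vertices c ≠ d with values of the first, so two
  -- of its values are no longer free.
  have hsub : {x ∈ I ×ˢ I | ¬ Disjoint (edgeImage H x.1) (edgeImage H x.2)} ⊆
      (univ : Finset (W × W × W × W)).biUnion fun k =>
        {x ∈ I ×ˢ I | k.2.2.1 ≠ k.2.2.2 ∧ x.1 k.1 = x.2 k.2.2.1 ∧ x.1 k.2.1 = x.2 k.2.2.2} := by
    intro x hx
    obtain ⟨hx, hd⟩ := mem_filter.1 hx
    obtain ⟨e, he1, he2⟩ := not_disjoint_iff.1 hd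
    obtain ⟨a, b, hab, rfl⟩ := mem_edgeImage.1 he1
    obtain ⟨c, d, hcd, h⟩ := mem_edgeImage.1 he2
    rw [mem_biUnion]
    rcases Sym2.eq_iff.1 h with ⟨h1, h2⟩ | ⟨h1, h2⟩
    · exact ⟨(a, b, c, d), mem_univ _, mem_filter.2 ⟨hx, hcd.ne, h1.symm, h2.symm⟩⟩
    · exact ⟨(a, b, d, c), mem_univ _, mem_filter.2 ⟨hx, hcd.ne', h2.symm, h1.symm⟩⟩
  refine (card_le_card hsub).trans ((card_biUnion_le_card_mul _ _
    (n ^ Fintype.card W * n ^ (Fintype.card W - 2)) fun k _ => ?_).trans_eq ?_)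
  · obtain ⟨a, b, c, d⟩ := k
    by_cases hcd : c = d
    · simp [hcd]
    · have := card_pairs_le {x ∈ I ×ˢ I | c ≠ d ∧ x.1 a = x.2 c ∧ x.1 b = x.2 d} ∅ {c, d} ?_
      · rwa [card_empty, card_pair hcd] at this
      · intro x hx y hy h1 h2
        have hx := (mem_filter.1 hx).2
        have hy := (mem_filter.1 hy).2
        have h3 : x.1 = y.1 := funext fun i => h1 i (notMem_empty i)
        refine Prod.ext h3 (funext fun i => ?_)
        by_cases hc : i = c
        · rw [hc, ← hx.2.1, ← hy.2.1, h3]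
        by_cases hd : i = d
        · rw [hd, ← hx.2.2, ← hy.2.2, h3]
        exact h2 i (by simp [hc, hd])
  · simp only [card_univ, Fintype.card_prod]
    ring

open Classical in
/-- The injective maps that send `a` to `u` and `b` to `v`. -/
noncomputable def rootedMaps (a b : W) (u v : Fin n) : Finset (W → Fin n) :=
  {φ | Function.Injective φ ∧ φ a = u ∧ φ b = v}

lemma mem_rootedMaps {a b : W} {u v : Fin n} {φ : W → Fin n} :
    φ ∈ rootedMaps a b u v ↔ Function.Injective φ ∧ φ a = u ∧ φ b = v := by
  simp [rootedMaps]

open Classical in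
/-- The number of pairs of rooted copies of `H` that share an edge other than the root. -/
lemma card_rooted_intersecting_le {a b : W} (hab : a ≠ b) (u v : Fin n) :
    n * #{x ∈ rootedMaps a b u v ×ˢ rootedMaps a b u v |
      ¬ Disjoint ((edgeImage H x.1).erase s(u, v)) ((edgeImage H x.2).erase s(u, v))} ≤
    Fintype.card W ^ 2 * (n ^ (Fintype.card W - 2) * n ^ (Fintype.card W - 2)) := by
  set I : Finset (W → Fin n) := rootedMaps a b u v
  have hsub : {x ∈ I ×ˢ I |
      ¬ Disjoint ((edgeImage H x.1).erase s(u, v)) ((edgeImage H x.2).erase s(u, v))} ⊆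
      (univ : Finset (W × W)).biUnion fun k =>
        {x ∈ I ×ˢ I | k.1 ≠ a ∧ k.1 ≠ b ∧ x.1 k.1 = x.2 k.2} := by
    intro x hx
    obtain ⟨hx, hd⟩ := mem_filter.1 hx
    obtain ⟨e, he1, he2⟩ := not_disjoint_iff.1 hd
    obtain ⟨hne, he1⟩ := mem_erase.1 he1
    obtain ⟨i, j, hij, rfl⟩ := mem_edgeImage.1 he1
    obtain ⟨k, l, hkl, h⟩ := mem_edgeImage.1 (mem_erase.1 he2).2
    obtain ⟨-, hu, hv⟩ := mem_rootedMaps.1 (mem_product.1 hx).1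
    -- The shared edge is not the root, so one of its ends is the image of a non-root vertex. That
    -- vertex costs the first map one further degree of freedom, which saves the factor n.
    have hcase : (i ≠ a ∧ i ≠ b) ∨ (j ≠ a ∧ j ≠ b) := by
      by_contra! hcon
      apply hne
      have := hij.ne
      by_cases hi : i = a
      · have hj : j = b := hcon.2 (by rintro rfl; exact this hi)
        rw [hi, hj, hu, hv]
      · have hi' := hcon.1 hi
        have hj : j = a := by
          by_contra hj
          exact this (hi'.trans (hcon.2 hj).symm)
        rw [hi', hj, hu, hv, Sym2.eq_swap]
    simp only [mem_biUnion, mem_univ, true_and, mem_filter, Prod.exists]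
    rcases Sym2.eq_iff.1 h with ⟨h1, h2⟩ | ⟨h1, h2⟩ <;> rcases hcase with hc | hc
    · exact ⟨i, k, hx, hc.1, hc.2, h1.symm⟩
    · exact ⟨j, l, hx, hc.1, hc.2, h2.symm⟩
    · exact ⟨i, l, hx, hc.1, hc.2, h2.symm⟩
    · exact ⟨j, k, hx, hc.1, hc.2, h1.symm⟩
  have hle : ∀ k : W × W, n * #{x ∈ I ×ˢ I | k.1 ≠ a ∧ k.1 ≠ b ∧ x.1 k.1 = x.2 k.2} ≤
      n ^ (Fintype.card W - 2) * n ^ (Fintype.card W - 2) := by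
    rintro ⟨c, d⟩
    by_cases hc : c ≠ a ∧ c ≠ b
    · have h3 : #{a, b, c} = 3 := card_eq_three.2 ⟨a, b, c, hab, hc.1.symm, hc.2.symm, rfl⟩
      have h3' : 3 ≤ Fintype.card W := h3 ▸ card_le_univ _
      have := card_pairs_le {x ∈ I ×ˢ I | c ≠ a ∧ c ≠ b ∧ x.1 c = x.2 d} {a, b, c} {a, b} ?_
      · rw [h3, card_pair hab] at this
        refine (Nat.mul_le_mul_left n this).trans_eq ?_
        rw [← mul_assoc, ← pow_succ', show Fintype.card W - 3 + 1 = Fintype.card W - 2 by omega]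
      · intro x hx y hy h1 h2
        obtain ⟨hx, hx'⟩ := mem_filter.1 hx
        obtain ⟨hy, hy'⟩ := mem_filter.1 hy
        have hx1 := (mem_rootedMaps.1 (mem_product.1 hx).1).2
        have hx2 := (mem_rootedMaps.1 (mem_product.1 hx).2).2
        have hy1 := (mem_rootedMaps.1 (mem_product.1 hy).1).2
        have hy2 := (mem_rootedMaps.1 (mem_product.1 hy).2).2
        have h4 : x.2 = y.2 := by
          funext i
          by_cases hia : i = a
          · rw [hia, hx2.1, hy2.1]
          by_cases hib : i = b
          · rw [hib, hx2.2, hy2.2]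
          exact h2 i (by simp [hia, hib])
        refine Prod.ext (funext fun i => ?_) h4
        by_cases hia : i = a
        · rw [hia, hx1.1, hy1.1]
        by_cases hib : i = b
        · rw [hib, hx1.2, hy1.2]
        by_cases hic : i = c
        · rw [hic, hx'.2.2, hy'.2.2, h4]
        exact h1 i (by simp [hia, hib, hic])
    · rw [filter_false_of_mem]
      · simp
      · rintro x - ⟨h1, h2, -⟩
        exact hc ⟨h1, h2⟩
  calc _ ≤ n * ∑ k : W × W, #{x ∈ I ×ˢ I | k.1 ≠ a ∧ k.1 ≠ b ∧ x.1 k.1 = x.2 k.2} :=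
        Nat.mul_le_mul_left n ((card_le_card hsub).trans card_biUnion_le)
    _ ≤ ∑ _k : W × W, n ^ (Fintype.card W - 2) * n ^ (Fintype.card W - 2) := by
        rw [mul_sum]
        exact sum_le_sum fun k _ => hle k
    _ = _ := by
        rw [sum_const, card_univ, Fintype.card_prod, smul_eq_mul]
        ring

/-- Any embedding of the other h - 2 vertices of `W` into the other n - 2 points extends to a rooted
map, and each factor of the falling factorial counting these embeddings is at least n + 1 - h. -/
lemma le_card_rootedMaps {a b : W} (hab : a ≠ b) {u v : Fin n} (huv : u ≠ v) :
    (n + 1 - Fintype.card W) ^ (Fintype.card W - 2) ≤ #(rootedMaps a b u v) := by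
  classical
  have hW : Fintype.card {w : W // w ∉ ({a, b} : Finset W)} = Fintype.card W - 2 := by
    rw [Fintype.card_subtype_compl, Fintype.card_coe, card_pair hab]
  have hV : Fintype.card {x : Fin n // x ∉ ({u, v} : Finset (Fin n))} = n - 2 := by
    rw [Fintype.card_subtype_compl, Fintype.card_coe, card_pair huv, Fintype.card_fin]
  have hW2 : 2 ≤ Fintype.card W := card_pair hab ▸ card_le_univ {a, b}
  have hV2 : 2 ≤ n := by
    have := card_le_univ ({u, v} : Finset (Fin n))
    rwa [card_pair huv, Fintype.card_fin] at this
  have h1 : (n + 1 - Fintype.card W) ^ (Fintype.card W - 2) ≤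
      Fintype.card ({w : W // w ∉ ({a, b} : Finset W)} ↪
        {x : Fin n // x ∉ ({u, v} : Finset (Fin n))}) := by
    rw [Fintype.card_embedding_eq, hW, hV]
    refine le_trans (le_of_eq ?_) (Nat.pow_sub_le_descFactorial _ _)
    congr 1
    omega
  refine h1.trans ?_
  rw [← card_univ]
  refine card_le_card_of_injOn (fun g w => if hw : w ∉ ({a, b} : Finset W) then (g ⟨w, hw⟩ : Fin n)
    else if w = a then u else v) ?_ ?_
  · intro g _
    rw [mem_coe, mem_rootedMaps]
    refine ⟨fun w w' h => ?_, by simp, by simp [hab.symm]⟩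
    by_cases hw : w ∉ ({a, b} : Finset W) <;> by_cases hw' : w' ∉ ({a, b} : Finset W)
    · simp only [dif_pos hw, dif_pos hw'] at h
      simpa using g.injective (Subtype.ext h)
    · simp only [dif_pos hw, dif_neg hw'] at h
      have := (g ⟨w, hw⟩).2
      rw [h] at this
      split_ifs at this <;> simp at this
    · simp only [dif_neg hw, dif_pos hw'] at h
      have := (g ⟨w', hw'⟩).2
      rw [← h] at this
      split_ifs at this <;> simp at this
    · simp only [dif_neg hw, dif_neg hw'] at h
      simp only [mem_insert, mem_singleton, not_not] at hw hw'
      split_ifs at h with h2 h3 h3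
      · rw [h2, h3]
      · exact absurd h huv
      · exact absurd h.symm huv
      · rw [hw.resolve_left h2, hw'.resolve_left h3]
  · intro g _ g' _ h
    ext w
    have := congrFun h w.1
    simp only [dif_pos w.2] at this
    exact congrArg Fin.val this

end Counting

/-! ### A typical missing edge creates many copies. -/

section Jumps

open Finset

variable {W : Type*} [Fintype W] {H : SimpleGraph W} {n : ℕ}

open Classical in
/-- Adding an edge creates all the copies of `H` rooted at that edge. -/
lemma labelledCount_add_le {a b : W} (hab : H.Adj a b) {u v : Fin n} {S : Finset (Sym2 (Fin n))}
    (he : s(u, v) ∉ S) :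
    labelledCount H S + #{φ ∈ rootedMaps a b u v | (edgeImage H φ).erase s(u, v) ⊆ S} ≤
      labelledCount H (insert s(u, v) S) := by
  rw [labelledCount, labelledCount, ← card_union_of_disjoint]
  · refine card_le_card fun φ hφ => ?_
    rw [mem_filter, mem_injectiveMaps]
    rcases mem_union.1 hφ with h | h
    · obtain ⟨h1, h2⟩ := mem_filter.1 h
      exact ⟨mem_injectiveMaps.1 h1, h2.trans (subset_insert _ _)⟩
    · obtain ⟨h1, h2⟩ := mem_filter.1 h
      refine ⟨(mem_rootedMaps.1 h1).1, ?_⟩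
      rw [subset_insert_iff]
      convert h2
  · refine disjoint_left.2 fun φ h h' => he ?_
    obtain ⟨-, h1, h2⟩ := mem_rootedMaps.1 (mem_filter.1 h').1
    exact (mem_filter.1 h).2 (mem_edgeImage.2 ⟨a, b, hab, by rw [h1, h2]⟩)

open Classical in
lemma card_edgeImage_le {V : Type*} (H : SimpleGraph W) (φ : W → V) :
    #(edgeImage H φ) ≤ #H.edgeFinset := card_image_le

open Classical in
/-- For any given pair of vertices, it is likely that joining them creates many copies of `H`. -/
lemma binProb_no_jump_le {a b : W} (hab : H.Adj a b) {p κ : ℝ} (hp0 : 0 < p) (hp1 : p < 1)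
    (hκ : κ = p ^ #H.edgeFinset / 2 ^ (Fintype.card W - 2)) (hn : 2 * Fintype.card W ≤ n)
    {e : Sym2 (Fin n)} (he : e ∈ (⊤ : SimpleGraph (Fin n)).edgeFinset) :
    binProb p (⊤ : SimpleGraph (Fin n)).edgeFinset (fun S => e ∉ S ∧
      ¬ ((labelledCount H S : ℝ) + κ / 2 * n ^ (Fintype.card W - 2) ≤
        labelledCount H (insert e S))) ≤ 4 * Fintype.card W ^ 2 / κ ^ 2 / n := by
  induction e with
  | h u v =>
  have huv : u ≠ v := by simpa using he
  have hW : 0 < Fintype.card W := Fintype.card_pos_iff.2 ⟨a⟩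
  have hn0 : (0 : ℝ) < n := by exact_mod_cast (by omega : 0 < n)
  have hκ0 : 0 < κ := by rw [hκ]; positivity
  set k := Fintype.card W - 2 with hk
  set I := rootedMaps a b u v with hI
  set A : (W → Fin n) → Finset (Sym2 (Fin n)) := fun φ => (edgeImage H φ).erase s(u, v) with hA
  have hcard : ((n : ℝ) / 2) ^ k ≤ #I := by
    have h1 := le_card_rootedMaps hab.ne huv
    rw [← hk] at h1
    refine le_trans ?_ (Nat.cast_le.2 h1)
    push_cast
    have h2 : n ≤ 2 * (n + 1 - Fintype.card W) := by omega
    have h3 : (n : ℝ) ≤ 2 * ((n + 1 - Fintype.card W : ℕ) : ℝ) := by exact_mod_cast h2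
    gcongr
    linarith
  -- In `κ`, the power of 2 comes from n + 1 - h ≥ n/2 and the power of p from each rooted copy
  -- having at most e(H) further edges. A jump below half of this bound is a deviation of at least
  -- `t` from the mean.
  have hmean : κ * n ^ k ≤ ∑ φ ∈ I, p ^ #(A φ) := by
    calc κ * n ^ k = (n / 2) ^ k * p ^ #H.edgeFinset := by
          rw [hκ, div_pow]; field_simp
      _ ≤ #I * p ^ #H.edgeFinset := by gcongr
      _ = ∑ φ ∈ I, p ^ #H.edgeFinset := by rw [sum_const, nsmul_eq_mul]
      _ ≤ _ := by
          refine sum_le_sum fun φ _ => pow_le_pow_of_le_one hp0.le hp1.le ?_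
          exact (card_le_card (erase_subset _ _)).trans (card_edgeImage_le H φ)
  have hcheb := binProb_chebyshev (U := (⊤ : SimpleGraph (Fin n)).edgeFinset)
    (P := fun S => s(u, v) ∉ S ∧ ¬ ((labelledCount H S : ℝ) + κ / 2 * n ^ k ≤
        labelledCount H (insert s(u, v) S))) hp0.le hp1.le I A
    (fun φ hφ => (erase_subset _ _).trans (edgeImage_subset (mem_rootedMaps.1 hφ).1))
    (t := κ / 2 * n ^ k) (by positivity) ?_
  · refine hcheb.trans ?_
    have h1 := card_rooted_intersecting_le (H := H) hab.ne u v
    have h2 : (n : ℝ) * #{x ∈ I ×ˢ I | ¬ Disjoint (A x.1) (A x.2)} ≤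
        Fintype.card W ^ 2 * (n ^ k * n ^ k) := by
      refine le_trans (le_of_eq ?_) ((Nat.cast_le (α := ℝ)).2 h1 |>.trans_eq ?_)
      · push_cast
        congr!
      · push_cast
        rfl
    rw [div_div, div_le_div_iff₀ (by positivity) (by positivity)]
    calc (#{x ∈ I ×ˢ I | ¬ Disjoint (A x.1) (A x.2)} : ℝ) * (κ ^ 2 * n)
        = (n * #{x ∈ I ×ˢ I | ¬ Disjoint (A x.1) (A x.2)}) * κ ^ 2 := by ring
      _ ≤ (Fintype.card W ^ 2 * (n ^ k * n ^ k)) * κ ^ 2 := by gcongr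
      _ = _ := by ring
  · rintro S - ⟨h1, h2⟩
    have h3 := labelledCount_add_le hab h1
    have h4 : (labelledCount H S : ℝ) + #{φ ∈ I | A φ ⊆ S} ≤
        labelledCount H (insert s(u, v) S) := by
      refine le_trans (le_of_eq ?_) (Nat.cast_le.2 h3)
      push_cast
      congr!
    rw [abs_sub_comm]
    refine le_trans ?_ (le_abs_self _)
    linarith

end Jumps

section Good

open Finset

variable {α : Type*} [DecidableEq α] {U : Finset α}

/-- Chebyshev for the family of singletons, whose intersecting pairs form the diagonal. -/
lemma binProb_card_sdiff_lt {p : ℝ} (hp0 : 0 ≤ p) (hp1 : p < 1) (hU : U.Nonempty) :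
    binProb p U (fun S => (#(U \ S) : ℝ) < (1 - p) / 2 * #U) ≤ 4 / (1 - p) ^ 2 / #U := by
  have hq : 0 < 1 - p := by linarith
  have hN : (0 : ℝ) < #U := by exact_mod_cast hU.card_pos
  refine (binProb_chebyshev hp0 hp1.le U (fun e => {e}) (fun e he => singleton_subset_iff.2 he)
    (t := (1 - p) / 2 * #U) (by positivity) fun S hS h => ?_).trans (le_of_eq ?_)
  · simp only [singleton_subset_iff, card_singleton, pow_one, sum_const, nsmul_eq_mul]
    rw [filter_mem_eq_inter, inter_eq_right.2 hS]
    rw [card_sdiff_of_subset hS, Nat.cast_sub (card_le_card hS)] at h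
    refine le_trans ?_ (le_abs_self _)
    linarith
  · have h1 : #{x ∈ U ×ˢ U | ¬ Disjoint ({x.1} : Finset α) {x.2}} = #U := by
      simp only [disjoint_singleton, ne_eq, not_not]
      rw [← diag_card U]
      congr 1
      ext ⟨x, y⟩
      simp only [mem_filter, mem_product, mem_diag]
      exact ⟨fun h => ⟨h.1.1, h.2⟩, fun h => ⟨⟨h.1, h.2 ▸ h.1⟩, h.2⟩⟩
    rw [h1]
    field_simp
    norm_num

/-- If the elements of `U` are unlikely to be exceptional, then it is unlikely that the random
set `S` leaves few non-exceptional elements of `U \ S`. -/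
lemma binProb_few_good_le {p δ : ℝ} (hp0 : 0 ≤ p) (hp1 : p < 1) (hU : U.Nonempty)
    (J : α → Finset α → Prop) [∀ S, DecidablePred fun e => J e S]
    (hJ : ∀ e ∈ U, binProb p U (fun S => e ∉ S ∧ ¬ J e S) ≤ δ) :
    binProb p U (fun S => (#{e ∈ U \ S | J e S} : ℝ) < (1 - p) / 4 * #U) ≤
      4 / (1 - p) ^ 2 / #U + 4 * δ / (1 - p) := by
  classical
  have hq : 0 < 1 - p := by linarith
  have hN : (0 : ℝ) < #U := by exact_mod_cast hU.card_pos
  -- If the complement has at least (1 - p)N/2 elements and fewer than (1 - p)N/4 are good, more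
  -- than (1 - p)N/4 are exceptional; Markov bounds the latter event.
  refine (binProb_le_add hp0 hp1.le (Q := fun S => (#(U \ S) : ℝ) < (1 - p) / 2 * #U)
    (R := fun S => (1 - p) / 4 * #U ≤ #{e ∈ U | e ∉ S ∧ ¬ J e S}) fun S _ h => ?_).trans
    (add_le_add (binProb_card_sdiff_lt hp0 hp1 hU) ?_)
  · by_contra! hcon
    have h1 := card_filter_add_card_filter_not (s := U \ S) (fun e => J e S)
    have h2 : {e ∈ U \ S | ¬ J e S} = {e ∈ U | e ∉ S ∧ ¬ J e S} := by
      ext e; simp [and_assoc]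
    rw [h2] at h1
    have h3 : (#{e ∈ U \ S | J e S} : ℝ) + #{e ∈ U | e ∉ S ∧ ¬ J e S} = #(U \ S) := by
      exact_mod_cast h1
    linarith [hcon.1, hcon.2]
  · have h1 : binExp p U (fun S => (#{e ∈ U | e ∉ S ∧ ¬ J e S} : ℝ)) ≤ #U * δ := by
      have h2 : ∀ S, (#{e ∈ U | e ∉ S ∧ ¬ J e S} : ℝ) =
          ∑ e ∈ U, if e ∉ S ∧ ¬ J e S then (1 : ℝ) else 0 := by
        intro S
        rw [card_filter]
        push_cast
        rfl
      rw [binExp_congr fun S _ => h2 S, binExp_sum, ← nsmul_eq_mul, ← sum_const]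
      refine sum_le_sum fun e he => (le_of_eq ?_).trans (hJ e he)
      rw [binProb]
      congr!
    refine (binProb_le_div hp0 hp1.le (t := (1 - p) / 4 * #U)
      (f := fun S => (#{e ∈ U | e ∉ S ∧ ¬ J e S} : ℝ)) (fun _ _ => by positivity)
      (by positivity) fun S _ h => h).trans ?_
    rw [div_le_div_iff₀ (by positivity) hq]
    nlinarith

end Good

/-! ### Anticoncentration and concentration of subgraph counts. -/

section SubgraphCounts

open Finset

variable {W : Type*} [Fintype W]

lemma sq_le_four_mul_card_edgeFinset_top {n : ℕ} (hn : 2 ≤ n) :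
    (n : ℝ) ^ 2 ≤ 4 * #(⊤ : SimpleGraph (Fin n)).edgeFinset := by
  rw [card_edgeFinset_top_eq_card_choose_two, Fintype.card_fin, Nat.cast_choose_two]
  have : (2 : ℝ) ≤ n := by exact_mod_cast hn
  nlinarith

/-- Anticoncentration of the number of labelled copies of `H`. -/
lemma exists_binProb_labelledCount_le {H : SimpleGraph W} {a b : W} (hab : H.Adj a b) {p K : ℝ}
    (hp0 : 0 < p) (hp1 : p < 1) (hK : 0 ≤ K) :
    ∃ C : ℝ, ∀ n : ℕ, 1 ≤ n → ∀ x : ℝ, binProb p (⊤ : SimpleGraph (Fin n)).edgeFinset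
      (fun S => |(labelledCount H S : ℝ) - x| ≤ K * (n : ℝ) ^ (Fintype.card W - 2)) ≤ C / n := by
  classical
  obtain ⟨B, hB0, hB⟩ := exists_binomial_le_div_sqrt hp0 hp1
  have hq : 0 < 1 - p := by linarith
  set h := Fintype.card W with hh
  set κ : ℝ := p ^ #H.edgeFinset / 2 ^ (h - 2) with hκ
  have hκ0 : 0 < κ := by positivity
  set γ : ℝ := (1 - p) / 4 with hγ
  have hγ0 : 0 < γ := by positivity
  set R : ℝ := (2 * K + κ / 2) / (κ / 2 * γ) with hR
  have hR0 : 0 ≤ R := by positivity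
  set Q : ℝ := 4 * h ^ 2 / κ ^ 2 with hQ
  have hQ0 : 0 ≤ Q := by positivity
  -- The summand 2h + 4 makes the bound trivial for small n. In the rest, `R` is (2r + d)/(dγ) after
  -- cancelling n^(h-2), and 2B/n bounds the point mass because √N ≥ n/2.
  refine ⟨(2 * h + 4) + (2 * B * R + (4 / (1 - p) ^ 2 + 4 * Q / (1 - p))), fun n hn x => ?_⟩
  have hn0 : (0 : ℝ) < n := by exact_mod_cast hn
  rcases lt_or_ge n (2 * h + 4) with hlt | hge
  · refine (binProb_le_one hp0.le hp1.le).trans ?_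
    rw [le_div_iff₀ hn0, one_mul]
    have h1 : (n : ℝ) ≤ 2 * h + 4 := by exact_mod_cast hlt.le
    have h2 : 0 ≤ 2 * B * R + (4 / (1 - p) ^ 2 + 4 * Q / (1 - p)) := by positivity
    linarith
  set U := (⊤ : SimpleGraph (Fin n)).edgeFinset with hU
  have hn4 : (4 : ℝ) ≤ n := by exact_mod_cast (by omega : 4 ≤ n)
  have hN := sq_le_four_mul_card_edgeFinset_top (n := n) (by omega)
  rw [← hU] at hN
  have hNn : (n : ℝ) ≤ #U := by nlinarith
  have hN0 : (0 : ℝ) < #U := by linarith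
  have hUne : U.Nonempty := card_pos.1 (by exact_mod_cast hN0)
  have hsqrt : (n : ℝ) / 2 ≤ √(#U : ℝ) := Real.le_sqrt_of_sq_le (by nlinarith)
  set d : ℝ := κ / 2 * (n : ℝ) ^ (h - 2) with hd
  have hd0 : 0 < d := by positivity
  have hmono : Monotone fun S : Finset (Sym2 (Fin n)) => (labelledCount H S : ℝ) :=
    fun S T hST => Nat.cast_le.2 (labelledCount_mono H hST)
  have hmain := binProb_le_of_jumps (U := U) hmono (p := p) (d := d) (γ := γ) (x := x)
    (r := K * (n : ℝ) ^ (h - 2)) (B := B / √(#U : ℝ)) hd0 (by positivity) hγ0 hUne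
    (hB #U hUne.card_pos) (P := fun S =>
      |(labelledCount H S : ℝ) - x| ≤ K * (n : ℝ) ^ (h - 2) ∧
      γ * #U ≤ #{e ∈ U \ S | (labelledCount H S : ℝ) + d ≤ labelledCount H (insert e S)})
    fun S _ hS => hS
  have hbad := binProb_few_good_le (U := U) (p := p) (δ := Q / n) hp0.le hp1 hUne
    (fun e S => (labelledCount H S : ℝ) + d ≤ labelledCount H (insert e S))
    fun e he => by
      have := binProb_no_jump_le hab hp0 hp1 (κ := κ) (n := n) (e := e)
        (by rw [hκ, hh]) (by omega) he
      exact this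
  refine (binProb_le_add hp0.le hp1.le (fun S _ hS => ?_)).trans ((add_le_add hmain hbad).trans ?_)
  · by_contra! hcon
    exact absurd (hcon.1 hS) (not_lt.2 hcon.2)
  have h1 : (2 * (K * (n : ℝ) ^ (h - 2)) + d) / (d * γ) = R := by
    rw [hR, hd]
    field_simp
  have h2 : B / √(#U : ℝ) ≤ 2 * B / n := by
    rw [div_le_div_iff₀ (by positivity) hn0]
    nlinarith
  have h3 : 4 / (1 - p) ^ 2 / #U ≤ 4 / (1 - p) ^ 2 / n := by gcongr
  rw [h1]
  calc B / √(#U : ℝ) * R + (4 / (1 - p) ^ 2 / #U + 4 * (Q / n) / (1 - p))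
      ≤ 2 * B / n * R + (4 / (1 - p) ^ 2 / n + 4 * (Q / n) / (1 - p)) := by gcongr
    _ = (2 * B * R + (4 / (1 - p) ^ 2 + 4 * Q / (1 - p))) / n := by field_simp
    _ ≤ _ := by
        refine div_le_div_of_nonneg_right (le_add_of_nonneg_left ?_) hn0.le
        positivity

/-- The number of labelled copies of `H` is likely to be close to its mean. -/
lemma binProb_labelledCount_far_le (H : SimpleGraph W) (hW : 2 ≤ Fintype.card W) {p : ℝ}
    (hp0 : 0 ≤ p) (hp1 : p ≤ 1) {n : ℕ} (hn : 1 ≤ n) :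
    binProb p (⊤ : SimpleGraph (Fin n)).edgeFinset (fun S =>
      2 * (Fintype.card W : ℝ) ^ 2 * n ^ (Fintype.card W - 1) ≤
        |(labelledCount H S : ℝ) - ∑ φ ∈ injectiveMaps (Fin n) W, p ^ #(edgeImage H φ)|) ≤
      1 / 4 := by
  have hn0 : (0 : ℝ) < n := by exact_mod_cast hn
  have hW0 : (0 : ℝ) < Fintype.card W := by exact_mod_cast (by omega : 0 < Fintype.card W)
  refine (binProb_chebyshev hp0 hp1 (injectiveMaps (Fin n) W) (edgeImage H)
    (fun φ hφ => edgeImage_subset (mem_injectiveMaps.1 hφ))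
    -- Twice the square root of the variance bound h⁴ n^(2h-2), whence the probability 1/4.
    (t := 2 * (Fintype.card W : ℝ) ^ 2 * n ^ (Fintype.card W - 1)) (by positivity)
    fun S _ hS => hS).trans ?_
  rw [div_le_div_iff₀ (by positivity) (by norm_num)]
  have h1 := (Nat.cast_le (α := ℝ)).2 (card_intersecting_le H n)
  have h2 : (n : ℝ) ^ Fintype.card W * n ^ (Fintype.card W - 2) =
      (n ^ (Fintype.card W - 1)) ^ 2 := by
    rw [← pow_add, ← pow_mul]
    congr 1
    omega
  push_cast at h1
  rw [h2] at h1
  calc _ ≤ (Fintype.card W : ℝ) ^ 4 * (n ^ (Fintype.card W - 1)) ^ 2 * 4 := by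
        refine mul_le_mul_of_nonneg_right (le_of_eq_of_le ?_ h1) (by norm_num)
        congr!
    _ = _ := by ring

lemma labelledCount_eq_card_iso_mul_copyCount (H : SimpleGraph W) {n : ℕ}
    {S : Finset (Sym2 (Fin n))} (hS : S ⊆ (⊤ : SimpleGraph (Fin n)).edgeFinset) :
    (labelledCount H S : ℝ) =
      Nat.card (H ≃g H) * ((fromEdgeSet (S : Set (Sym2 (Fin n)))).copyCount H : ℝ) := by
  rw [labelledCount_eq (fromEdgeSet (S : Set (Sym2 (Fin n)))), labelledCopyCount_eq_card_iso_mul,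
    Nat.cast_mul]
  ext e
  simp only [edgeSet_fromEdgeSet, Set.mem_sdiff, mem_coe]
  exact ⟨fun h => h.1, fun h => ⟨h, by simpa using hS h⟩⟩

/-- If a random natural number is likely to be within `D * n` multiples of `r` of its mean,
then it hits some interval of length `r` with probability of order `1 / n`. -/
lemma exists_le_binProb_of_concentrated {α : Type*} {U : Finset α} {p : ℝ} (hp0 : 0 ≤ p)
    (hp1 : p ≤ 1) (X : Finset α → ℕ) {ν : ℝ} (hν : 0 ≤ ν) {r D n : ℕ} (hr : 0 < r) (hn : 1 ≤ n)
    (hX : binProb p U (fun S => (D * n * r : ℝ) ≤ |(X S : ℝ) - ν * r|) ≤ 1 / 4) :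
    ∃ x : ℕ, 3 / 4 / (2 * D + 5 : ℝ) / n ≤ binProb p U fun S => |(X S : ℝ) - x| ≤ r := by
  classical
  by_contra! hcon
  have hn0 : (0 : ℝ) < n := by exact_mod_cast hn
  have hr0 : (0 : ℝ) < r := by exact_mod_cast hr
  set k₀ := ⌊ν⌋₊ with hk₀
  -- The candidates for x are the multiples kr with k in `I`: a value of X is within r of r⌊X/r⌋.
  -- Truncated subtraction is harmless, as k is a natural number.
  set I := Icc (k₀ - (D * n + 2)) (k₀ + (D * n + 1)) with hI
  have hcover : ∀ S ⊆ U, ¬ ((D * n * r : ℝ) ≤ |(X S : ℝ) - ν * r|) →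
      ∃ k ∈ I, |(X S : ℝ) - (k * r : ℕ)| ≤ r := by
    intro S _ hS
    rw [not_le, abs_lt] at hS
    have h1 : ((X S / r : ℕ) : ℝ) * r ≤ X S := by exact_mod_cast Nat.div_mul_le_self _ _
    have h2 : (X S : ℝ) < ((X S / r : ℕ) + 1) * r := by
      exact_mod_cast Nat.lt_mul_of_div_lt (Nat.lt_succ_self _) hr
    have h3 : (k₀ : ℝ) ≤ ν := Nat.floor_le hν
    have h4 : ν < k₀ + 1 := Nat.lt_floor_add_one _
    generalize X S / r = k at h1 h2
    refine ⟨k, mem_Icc.2 ⟨?_, ?_⟩, ?_⟩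
    · have h5 : (k₀ : ℝ) < k + 1 + D * n := by
        refine lt_of_mul_lt_mul_right ?_ hr0.le
        nlinarith
      have h6 : k₀ < k + 1 + D * n := by exact_mod_cast h5
      omega
    · have h5 : (k : ℝ) < k₀ + 1 + D * n := by
        refine lt_of_mul_lt_mul_right ?_ hr0.le
        nlinarith
      have h6 : k < k₀ + 1 + D * n := by exact_mod_cast h5
      omega
    · push_cast
      rw [abs_le]
      constructor <;> linarith
  have hsum : binProb p U (fun S => ¬ ((D * n * r : ℝ) ≤ |(X S : ℝ) - ν * r|)) ≤
      ∑ k ∈ I, binProb p U fun S => |(X S : ℝ) - (k * r : ℕ)| ≤ r := by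
    simp only [binProb]
    rw [← binExp_sum]
    refine binExp_mono hp0 hp1 fun S hS => ?_
    have hnn : ∀ k ∈ I, (0 : ℝ) ≤ if |(X S : ℝ) - (k * r : ℕ)| ≤ r then 1 else 0 :=
      fun k _ => by split_ifs <;> norm_num
    split_ifs with hP
    · exact sum_nonneg hnn
    · obtain ⟨k, hk, hkS⟩ := hcover S hS hP
      exact (if_pos hkS).symm.trans_le (single_le_sum hnn hk)
  have hcard : (#I : ℝ) ≤ (2 * D + 5) * n := by
    have h1 : #I ≤ 2 * (D * n) + 4 := by rw [hI, Nat.card_Icc]; omega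
    have h2 : (#I : ℝ) ≤ 2 * (D * n) + 4 := by exact_mod_cast h1
    have h3 : (1 : ℝ) ≤ n := by exact_mod_cast hn
    nlinarith
  have hIne : I.Nonempty := nonempty_Icc.2 (by omega)
  have hlt : ∑ k ∈ I, binProb p U (fun S => |(X S : ℝ) - (k * r : ℕ)| ≤ r) <
      ∑ _k ∈ I, 3 / 4 / (2 * D + 5 : ℝ) / n := sum_lt_sum_of_nonempty hIne fun k _ => hcon (k * r)
  have hle : ∑ _k ∈ I, 3 / 4 / (2 * D + 5 : ℝ) / n ≤ 3 / 4 := by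
    rw [sum_const, nsmul_eq_mul]
    calc (#I : ℝ) * (3 / 4 / (2 * D + 5 : ℝ) / n)
        ≤ ((2 * D + 5) * n) * (3 / 4 / (2 * D + 5 : ℝ) / n) := by gcongr
      _ = 3 / 4 := by field_simp
  have := binProb_add_not (p := p) (U := U) (P := fun S => (D * n * r : ℝ) ≤ |(X S : ℝ) - ν * r|)
  linarith

end SubgraphCounts

theorem theorem1p7 {W : Type*} [Fintype W] (H : SimpleGraph W) (hH : H.edgeSet.Nonempty)
    (p : unitInterval) (hp0 : 0 < p) (hp1 : p < 1) :
    (∃ C : ℝ, ∀ n : ℕ, 1 ≤ n → ∀ x : ℝ,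
      (binomialRandom (Fin n) p).real
        {G | |(G.copyCount H : ℝ) - x| ≤ (n : ℝ) ^ (Fintype.card W - 2)} ≤ C / n) ∧
    (∃ c : ℝ, 0 < c ∧ ∀ n : ℕ, 1 ≤ n → ∃ x : ℕ,
      c / n ≤ (binomialRandom (Fin n) p).real
        {G | |(G.copyCount H : ℝ) - x| ≤ (n : ℝ) ^ (Fintype.card W - 2)}) := by
  have hp0' : (0 : ℝ) < p := hp0
  have hp1' : (p : ℝ) < 1 := hp1
  obtain ⟨e, he⟩ := hH
  induction e with
  | h a b =>
  have hab : H.Adj a b := he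
  have hW : 2 ≤ Fintype.card W := Fintype.one_lt_card_iff.2 ⟨a, b, hab.ne⟩
  have : Finite (H ≃g H) := Finite.of_injective _ (DFunLike.coe_injective (F := H ≃g H))
  have : Nonempty (H ≃g H) := ⟨Iso.refl⟩
  set m := Nat.card (H ≃g H) with hm
  have hm1 : 1 ≤ m := Nat.card_pos
  have hm1' : (1 : ℝ) ≤ m := by exact_mod_cast hm1
  have hm0 : (0 : ℝ) < m := by linarith
  constructor
  -- Passing to labelled copies multiplies both the centre and the width of the window by |Aut H|,
  -- hence K = m.
  · obtain ⟨C, hC⟩ := exists_binProb_labelledCount_le hab hp0' hp1' hm0.le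
    refine ⟨C, fun n hn x => ?_⟩
    rw [binomialRandom_real_eq_binProb]
    refine (binProb_mono hp0'.le hp1'.le fun S hS h => ?_).trans (hC n hn (m * x))
    rw [labelledCount_eq_card_iso_mul_copyCount H hS, ← mul_sub, abs_mul, abs_of_pos hm0]
    exact mul_le_mul_of_nonneg_left h hm0.le
  · set D := 2 * Fintype.card W ^ 2 with hD
    refine ⟨3 / 4 / (2 * D + 5 : ℝ), by positivity, fun n hn => ?_⟩
    have hn0 : (0 : ℝ) < n := by exact_mod_cast hn
    set μ : ℝ := ∑ φ ∈ injectiveMaps (Fin n) W, (p : ℝ) ^ Finset.card (edgeImage H φ) with hμ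
    have hμ0 : 0 ≤ μ := Finset.sum_nonneg fun φ _ => by positivity
    have hfar : binProb p (⊤ : SimpleGraph (Fin n)).edgeFinset (fun S =>
        (D * n * (n ^ (Fintype.card W - 2) : ℕ) : ℝ) ≤
        |((fromEdgeSet (S : Set (Sym2 (Fin n)))).copyCount H : ℝ) -
          μ / m / (n ^ (Fintype.card W - 2) : ℕ) * (n ^ (Fintype.card W - 2) : ℕ)|) ≤ 1 / 4 := by
      refine (binProb_mono hp0'.le hp1'.le fun S hS h => ?_).trans
        (binProb_labelledCount_far_le H hW hp0'.le hp1'.le hn)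
      have h1 : (0 : ℝ) < (n ^ (Fintype.card W - 2) : ℕ) := by positivity
      rw [div_mul_cancel₀ _ h1.ne'] at h
      rw [labelledCount_eq_card_iso_mul_copyCount H hS, ← hm, ← hμ]
      set X : ℝ := ((fromEdgeSet (S : Set (Sym2 (Fin n)))).copyCount H : ℝ)
      have h2 : (m : ℝ) * X - μ = m * (X - μ / m) := by field_simp
      rw [h2, abs_mul, abs_of_pos hm0]
      have h3 : (n : ℝ) * (n ^ (Fintype.card W - 2) : ℕ) = n ^ (Fintype.card W - 1) := by
        push_cast
        rw [← pow_succ']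
        congr 1
        omega
      rw [mul_assoc (D : ℝ), h3, hD] at h
      push_cast at h
      exact h.trans (le_mul_of_one_le_left (abs_nonneg _) hm1')
    obtain ⟨x, hx⟩ := exists_le_binProb_of_concentrated (D := D) (n := n)
      (U := (⊤ : SimpleGraph (Fin n)).edgeFinset) hp0'.le hp1'.le
      (fun S => (fromEdgeSet (S : Set (Sym2 (Fin n)))).copyCount H)
      (r := n ^ (Fintype.card W - 2)) (ν := μ / m / (n ^ (Fintype.card W - 2) : ℕ))
      (by positivity) (by positivity) hn hfar
    refine ⟨x, ?_⟩
    rw [binomialRandom_real_eq_binProb]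
    simpa using hx
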